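/- **Setting.** Fix $T,\lambda>0$ and types $\theta,\tilde\theta\in[\theta_L,\theta_H]$, a risk aversion $\gamma(\cdot)>0$ and a risk loading $\xi(\cdot)\ge 0$ on $[\theta_L,\theta_H]$. For each type $\vartheta\in[\theta_L,\theta_H]$ let $f(\cdot;\vartheta)$ be a probability density on $(0,\infty)$ with finite first and second moments. The claims of a type-$\theta$ customer arrive on $[0,T]$ according to a Poisson process $N$ of intensity $\lambda$, and the claim sizes $Y_1,Y_2,\dots$ are i.i.d. with density $f(\cdot;\theta)$ and independent of $N$; let $N^\theta(ds,dy)$ be the associated jump measure on $[0,T]\times(0,\infty)$. An admissible coverage is a Borel function $l(t,y)$ with $0\le l(t,y)\le y$ for $t\in[0,T]$, $y\ge0$. Under the type-$\tilde\theta$ contract the coverage $l$ costs the premium rate $p_s(l)=(1+\xi(\tilde\theta))\lambda\int_0^\infty l(s,y)f(y;\tilde\theta)\,dy$ at time $s$. The surplus at time $T$ of a type-$\theta$ customer whose surplus at time $t$ is $x$ is $$X^{t,x}_T(l)=x-\int_t^T p_s(l)\,ds-\int_{(t,T]}\int_{(0,\infty)}(y-l(s,y))\,N^\theta(ds,dy),$$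 and $J(t,x,l)=\mathbb E[X^{t,x}_T(l)]-\frac{\gamma(\theta)}2\operatorname{Var}[X^{t,x}_T(l)]$. The customer's problem, with initial surplus $x_C$, is $V_C^\theta(\tilde\theta)=\sup_l J(0,x_C,l)$ over admissible $l$. An admissible $\hat l$ is an equilibrium strategy if for all $(t,x)\in[0,T]\times\mathbb R$ and all $\bar l:\mathbb R\to\mathbb R$ such that the perturbed strategies $l^\varepsilon$ (equal to $\bar l(y)$ for $s\in[t,t+\varepsilon)$ and to $\hat l(s,y)$ otherwise) are admissible for all small $\varepsilon>0$, one has $\liminf_{\varepsilon\downarrow0}\frac{J(t,x,\hat l)-J(t,x,l^\varepsilon)}{\varepsilon}\ge0$. **Proposition.** For every admissible $l$ and all $(t,x)\in[0,T]\times\mathbb R$ the surplus $X^{t,x}_T(l)$ is square-integrable. An optimal coverage for the customer's problem is $$\hat l^\theta(y;\tilde\theta)=\left(\left(y+\frac1{\gamma(\theta)}-\frac{f(y;\tilde\theta)(1+\xi(\tilde\theta))}{\gamma(\theta)f(y;\theta)}\right)\vee0\right)\wedge y,\qquad y>0$$ (read as $0$ where $f(y;\theta)=0$): it is an equilibrium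 strategy, and it attains the supremum that defines $V_C^\theta(\tilde\theta)$. The value function is $$V_C^\theta(\tilde\theta)=J(0,x_C,\hat l^\theta(\cdot;\tilde\theta))=x_C-\lambda T\left[\int_0^\infty(1+\xi(\tilde\theta))\,\hat l^\theta(y;\tilde\theta)f(y;\tilde\theta)\,dy+\int_0^\infty\left(\big(y-\hat l^\theta(y;\tilde\theta)\big)+\frac{\gamma(\theta)}2\big(y-\hat l^\theta(y;\tilde\theta)\big)^2\right)f(y;\theta)\,dy\right].$$ -/

import Mathlib

open MeasureTheory ProbabilityTheory Filter Topology

noncomputable section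

namespace RiskType

/-- `g` is the density of a positive claim size with finite first and second moments
(only the values of `g` on `(0, ∞)` matter). -/
structure IsClaimDensity (g : ℝ → ℝ) : Prop where
  measurable : Measurable g
  nonneg : ∀ y, 0 < y → 0 ≤ g y
  lintegral_eq_one : ∫⁻ y in Set.Ioi (0 : ℝ), ENNReal.ofReal (g y) = 1
  integrable_mul : IntegrableOn (fun y => y * g y) (Set.Ioi 0)
  integrable_sq_mul : IntegrableOn (fun y => y ^ 2 * g y) (Set.Ioi 0)

/-- `N` is (the restriction to `[0, T]` of) a homogeneous Poisson process with intensity `lam`: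
a right-continuous counting process started at `0` whose increments are independent and
Poisson distributed. -/
structure IsPoissonProcess {Ω : Type*} [MeasurableSpace Ω] (P : Measure Ω) (T lam : ℝ)
    (N : ℝ → Ω → ℕ) : Prop where
  measurable : ∀ t ∈ Set.Icc 0 T, Measurable (N t)
  zero : ∀ ω, N 0 ω = 0
  monotone : ∀ ω, MonotoneOn (fun t => N t ω) (Set.Icc 0 T)
  rightContinuous : ∀ ω, ∀ t ∈ Set.Icc 0 T,
    ContinuousWithinAt (fun s => N s ω) (Set.Icc t T) t
  indepIncrements : HasIndepIncrements (fun (t : Set.Icc (0 : ℝ) T) ω => N t ω) P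
  law_increment : ∀ s ∈ Set.Icc 0 T, ∀ t ∈ Set.Icc 0 T, s ≤ t →
    HasLaw (fun ω => N t ω - N s ω) (poissonMeasure (Real.toNNReal (lam * (t - s)))) P

/-- The Cramér–Lundberg model on `[0, T]`: claims arrive according to the Poisson process `N`
with intensity `lam`; the claim sizes `Y 0, Y 1, …` (in order of arrival) are independent and
identically distributed with density `g` on `(0, ∞)`, and they are independent of `N`. -/
structure IsClaimModel {Ω : Type*} [MeasurableSpace Ω] (P : Measure Ω) (T lam : ℝ) (g : ℝ → ℝ)
    (N : ℝ → Ω → ℕ) (Y : ℕ → Ω → ℝ) : Prop where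
  poisson : IsPoissonProcess P T lam N
  law_claim : ∀ i, HasLaw (Y i)
    ((volume.restrict (Set.Ioi (0 : ℝ))).withDensity fun y => ENNReal.ofReal (g y)) P
  indep_claims : iIndepFun Y P
  indep_arrivals : IndepFun (fun ω (i : ℕ) => Y i ω)
    (fun ω (t : Set.Icc (0 : ℝ) T) => N t ω) P

/-- The arrival time of claim number `i` (counted from `0`); meaningful if `i < N T ω`. -/
def arrivalTime {Ω : Type*} (T : ℝ) (N : ℝ → Ω → ℕ) (i : ℕ) (ω : Ω) : ℝ :=
  sInf {s : ℝ | s ∈ Set.Icc 0 T ∧ i < N s ω}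

/-- The integral `∫_{(t, r]} ∫_{(0, ∞)} h(s, y) N(ds, dy)` of `h` against the jump measure: the
sum of `h` over the claims arriving during `(t, r]`. -/
def jumpIntegral {Ω : Type*} (T : ℝ) (N : ℝ → Ω → ℕ) (Y : ℕ → Ω → ℝ) (h : ℝ → ℝ → ℝ)
    (t r : ℝ) (ω : Ω) : ℝ :=
  ∑ i ∈ Finset.Ico (N t ω) (N r ω), h (arrivalTime T N i ω) (Y i ω)

/-- Admissible coverage functions `l(t, y)`: measurable, and the indemnity neither is negative
nor exceeds the loss. -/
def Admissible (T : ℝ) (l : ℝ → ℝ → ℝ) : Prop :=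
  Measurable (Function.uncurry l) ∧
    ∀ t ∈ Set.Icc 0 T, ∀ y, 0 ≤ y → 0 ≤ l t y ∧ l t y ≤ y

/-- Premium rate at time `s` for the coverage `l` by the expected-value principle, in a contract
with risk loading `ξ` that is priced with the claim density `g`. -/
def premiumRate (lam ξ : ℝ) (g : ℝ → ℝ) (l : ℝ → ℝ → ℝ) (s : ℝ) : ℝ :=
  (1 + ξ) * lam * ∫ y in Set.Ioi (0 : ℝ), l s y * g y

/-- The customer's surplus at time `r ≥ t` when it equals `x` at time `t`. -/
def surplus {Ω : Type*} (T lam ξ : ℝ) (g : ℝ → ℝ) (N : ℝ → Ω → ℕ) (Y : ℕ → Ω → ℝ)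
    (l : ℝ → ℝ → ℝ) (t x r : ℝ) (ω : Ω) : ℝ :=
  x - (∫ s in t..r, premiumRate lam ξ g l s) - jumpIntegral T N Y (fun s y => y - l s y) t r ω

/-- Mean–variance criterion `J(t, x, l)` of the terminal surplus, with risk aversion `a`, for the
surplus that equals `x` at time `t`. -/
def criterion {Ω : Type*} [MeasurableSpace Ω] (P : Measure Ω) (T lam ξ a : ℝ) (g : ℝ → ℝ)
    (N : ℝ → Ω → ℕ) (Y : ℕ → Ω → ℝ) (t x : ℝ) (l : ℝ → ℝ → ℝ) : ℝ :=
  (∫ ω, surplus T lam ξ g N Y l t x T ω ∂P)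
    - a / 2 * variance (surplus T lam ξ g N Y l t x T) P

open Classical in
/-- The coverage that follows `lbar` during `[t, t + ε)` and `l` at all other times. -/
def perturb (l : ℝ → ℝ → ℝ) (lbar : ℝ → ℝ) (t ε : ℝ) : ℝ → ℝ → ℝ :=
  fun s y => if s ∈ Set.Ico t (t + ε) then lbar y else l s y

/-- `l` is an equilibrium strategy for the criterion `J` over the horizon `[0, T]`. The lower limit
is taken in the extended reals. -/
def IsEquilibrium (T : ℝ) (J : ℝ → ℝ → (ℝ → ℝ → ℝ) → ℝ) (l : ℝ → ℝ → ℝ) : Prop :=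
  Admissible T l ∧
    ∀ t ∈ Set.Icc 0 T, ∀ x : ℝ, ∀ lbar : ℝ → ℝ,
      (∀ᶠ ε in 𝓝[>] (0 : ℝ), Admissible T (perturb l lbar t ε)) →
        (0 : EReal) ≤ liminf
          (fun ε : ℝ => (((J t x l - J t x (perturb l lbar t ε)) / ε : ℝ) : EReal)) (𝓝[>] 0)

/-- The value of the customer's problem `sup_l J(0, x, l)` over admissible coverages. -/
def customerValue (T : ℝ) (J : ℝ → ℝ → (ℝ → ℝ → ℝ) → ℝ) (x : ℝ) : ℝ :=
  sSup (J 0 x '' {l | Admissible T l})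

open Classical in
/-- The coverage `((y + 1/a - g̃(y)(1 + ξ)/(a g(y))) ∨ 0) ∧ y`, where `a` is the customer's risk
aversion, `g` the density of the customer's claims and `g̃` the density used for pricing. Where
`g y = 0` the quotient is read as `+∞`, so that the coverage is `0`. -/
def optimalCoverage (ξ a : ℝ) (gtilde g : ℝ → ℝ) (y : ℝ) : ℝ :=
  if g y = 0 then min 0 y
  else min (max (y + 1 / a - gtilde y * (1 + ξ) / (a * g y)) 0) y

end RiskType

end

namespace RiskType

open scoped ENNReal NNReal

section MarkedPoints

variable {Ω α β : Type*} [MeasurableSpace Ω] [MeasurableSpace α] [MeasurableSpace β]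
  {P : Measure Ω}

lemma lintegral_comp_of_indepFun [IsProbabilityMeasure P] {X : Ω → α} {Z : Ω → β} (h : IndepFun X Z P)
    (hX : AEMeasurable X P) (hZ : AEMeasurable Z P) {F : α → β → ℝ≥0∞}
    (hF : Measurable (Function.uncurry F)) :
    ∫⁻ ω, F (X ω) (Z ω) ∂P = ∫⁻ ω, ∫⁻ x, F x (Z ω) ∂(P.map X) ∂P := by
  have h1 := (indepFun_iff_map_prod_eq_prod_map_map hX hZ).1 h
  have : IsProbabilityMeasure (P.map X) := Measure.isProbabilityMeasure_map hX
  have : IsProbabilityMeasure (P.map Z) := Measure.isProbabilityMeasure_map hZ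
  calc ∫⁻ ω, F (X ω) (Z ω) ∂P
      = ∫⁻ p, Function.uncurry F p ∂(P.map fun ω => (X ω, Z ω)) :=
        (lintegral_map' hF.aemeasurable (hX.prodMk hZ)).symm
    _ = ∫⁻ z, ∫⁻ x, F x z ∂(P.map X) ∂(P.map Z) := by
        rw [h1, lintegral_prod_symm _ hF.aemeasurable]; rfl
    _ = _ := lintegral_map' (Measurable.lintegral_prod_left' hF).aemeasurable hZ

/-- The intensity measure of the point process with points `τ i`, `i < K`. -/
noncomputable def intensity (P : Measure Ω) (τ : ℕ → Ω → ℝ) (K : Ω → ℕ) : Measure ℝ :=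
  Measure.sum fun i => (P.restrict {ω | i < K ω}).map (τ i)

/-- The second moment measure of the point process with points `τ i`, `i < K`. -/
noncomputable def secondMoment (P : Measure Ω) (τ : ℕ → Ω → ℝ) (K : Ω → ℕ) : Measure (ℝ × ℝ) :=
  Measure.sum fun p : ℕ × ℕ =>
    (P.restrict {ω | p.1 < K ω ∧ p.2 < K ω}).map fun ω => (τ p.1 ω, τ p.2 ω)

variable {τ : ℕ → Ω → ℝ} {K : Ω → ℕ}

lemma lintegral_intensity (hτ : ∀ i, Measurable (τ i)) (hK : Measurable K) {g : ℝ → ℝ≥0∞}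
    (hg : Measurable g) :
    ∫⁻ s, g s ∂(intensity P τ K) = ∑' i, ∫⁻ ω, (if i < K ω then g (τ i ω) else 0) ∂P := by
  rw [intensity, lintegral_sum_measure]
  refine tsum_congr fun i => ?_
  rw [lintegral_map hg (hτ i), ← lintegral_indicator (measurableSet_lt measurable_const hK)]
  simp [Set.indicator_apply]

lemma lintegral_secondMoment (hτ : ∀ i, Measurable (τ i)) (hK : Measurable K)
    {g : ℝ × ℝ → ℝ≥0∞} (hg : Measurable g) :
    ∫⁻ s, g s ∂(secondMoment P τ K) = ∑' p : ℕ × ℕ,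
      ∫⁻ ω, (if p.1 < K ω ∧ p.2 < K ω then g (τ p.1 ω, τ p.2 ω) else 0) ∂P := by
  rw [secondMoment, lintegral_sum_measure]
  refine tsum_congr fun p => ?_
  have hm : MeasurableSet {ω | p.1 < K ω ∧ p.2 < K ω} :=
    (measurableSet_lt measurable_const hK).inter (measurableSet_lt measurable_const hK)
  rw [lintegral_map hg ((hτ _).prodMk (hτ _)), ← lintegral_indicator hm]
  simp [Set.indicator_apply]

/-- The sum of `φ` over the points `τ i`, `i < K`, with marks `Y i`. -/
noncomputable def markedSum (τ : ℕ → Ω → ℝ) (K : Ω → ℕ) (Y : ℕ → Ω → ℝ) (φ : ℝ → ℝ → ℝ≥0∞)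
    (ω : Ω) : ℝ≥0∞ :=
  ∑' i, if i < K ω then φ (τ i ω) (Y i ω) else 0

variable {Y : ℕ → Ω → ℝ} {ν : Measure ℝ} {φ : ℝ → ℝ → ℝ≥0∞}

omit [MeasurableSpace Ω] in
lemma markedSum_eq_sum (ω : Ω) :
    markedSum τ K Y φ ω = ∑ i ∈ Finset.range (K ω), φ (τ i ω) (Y i ω) := by
  rw [markedSum, tsum_eq_sum (s := Finset.range (K ω)) (by simp +contextual)]
  exact Finset.sum_congr rfl fun i hi => if_pos (by simpa using hi)

lemma aemeasurable_markedSum_term (hτ : ∀ i, Measurable (τ i)) (hK : Measurable K)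
    (hY : ∀ i, AEMeasurable (Y i) P) (hφ : Measurable (Function.uncurry φ)) (i : ℕ) :
    AEMeasurable (fun ω => if i < K ω then φ (τ i ω) (Y i ω) else 0) P := by
  have := (hφ.comp_aemeasurable ((hτ i).aemeasurable.prodMk (hY i))).indicator
    (measurableSet_lt (f := fun _ => i) measurable_const hK)
  refine this.congr (ae_of_all _ fun ω => ?_)
  simp [Set.indicator_apply, Function.uncurry]

lemma aemeasurable_markedSum (hτ : ∀ i, Measurable (τ i)) (hK : Measurable K)
    (hY : ∀ i, AEMeasurable (Y i) P) (hφ : Measurable (Function.uncurry φ)) :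
    AEMeasurable (markedSum τ K Y φ) P :=
  AEMeasurable.tsum fun i => aemeasurable_markedSum_term hτ hK hY hφ i

variable [IsProbabilityMeasure P] (hτ : ∀ i, Measurable (τ i)) (hK : Measurable K) (hY : ∀ i, HasLaw (Y i) ν P)
  (hind : IndepFun (fun ω i => Y i ω) (fun ω => (fun i => τ i ω, K ω)) P)
  (hφ : Measurable (Function.uncurry φ))

include hτ hK hY hind hφ

lemma lintegral_markedSum_term (i : ℕ) :
    ∫⁻ ω, (if i < K ω then φ (τ i ω) (Y i ω) else 0) ∂P =
      ∫⁻ ω, (if i < K ω then ∫⁻ y, φ (τ i ω) y ∂ν else 0) ∂P := by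
  have h : IndepFun (Y i) (fun ω => (τ i ω, K ω)) P :=
    hind.comp (φ := fun y : ℕ → ℝ => y i) (ψ := fun z : (ℕ → ℝ) × ℕ => (z.1 i, z.2))
      (by fun_prop) (by fun_prop)
  have := lintegral_comp_of_indepFun h (hY i).aemeasurable ((hτ i).prodMk hK).aemeasurable
    (F := fun y z => if i < z.2 then φ z.1 y else 0)
    (Measurable.ite (measurableSet_lt measurable_const (by fun_prop))
      (hφ.comp (by fun_prop : Measurable fun p : ℝ × ℝ × ℕ => (p.2.1, p.1))) measurable_const)
  rw [this, (hY i).map_eq]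
  refine lintegral_congr fun ω => ?_
  split_ifs <;> simp

lemma lintegral_markedSum [SFinite ν] :
    ∫⁻ ω, markedSum τ K Y φ ω ∂P = ∫⁻ s, ∫⁻ y, φ s y ∂ν ∂(intensity P τ K) := by
  have hΦ : Measurable fun s => ∫⁻ y, φ s y ∂ν := hφ.lintegral_prod_right'
  rw [lintegral_intensity hτ hK hΦ]
  simp only [markedSum]
  rw [lintegral_tsum fun i => aemeasurable_markedSum_term hτ hK (fun i => (hY i).aemeasurable) hφ i]
  exact tsum_congr fun i => lintegral_markedSum_term hτ hK hY hind hφ i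

lemma lintegral_markedSum_pair [SFinite ν] (hYi : iIndepFun Y P) {i j : ℕ} (hij : i ≠ j) :
    ∫⁻ ω, (if i < K ω ∧ j < K ω then φ (τ i ω) (Y i ω) * φ (τ j ω) (Y j ω) else 0) ∂P =
      ∫⁻ ω, (if i < K ω ∧ j < K ω then
        (∫⁻ y, φ (τ i ω) y ∂ν) * ∫⁻ y, φ (τ j ω) y ∂ν else 0) ∂P := by
  have h : IndepFun (fun ω => (Y i ω, Y j ω)) (fun ω => (τ i ω, τ j ω, K ω)) P :=
    hind.comp (φ := fun y : ℕ → ℝ => (y i, y j)) (ψ := fun z : (ℕ → ℝ) × ℕ => (z.1 i, z.1 j, z.2))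
      (by fun_prop) (by fun_prop)
  have hK' : Measurable fun p : (ℝ × ℝ) × ℝ × ℝ × ℕ => p.2.2.2 := by fun_prop
  have hm : MeasurableSet {p : (ℝ × ℝ) × ℝ × ℝ × ℕ | i < p.2.2.2 ∧ j < p.2.2.2} :=
    (measurableSet_lt measurable_const hK').inter (measurableSet_lt measurable_const hK')
  have := lintegral_comp_of_indepFun h ((hY i).aemeasurable.prodMk (hY j).aemeasurable)
    ((hτ i).prodMk ((hτ j).prodMk hK)).aemeasurable
    (F := fun y z => if i < z.2.2 ∧ j < z.2.2 then φ z.1 y.1 * φ z.2.1 y.2 else 0)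
    (Measurable.ite hm
      ((hφ.comp (by fun_prop : Measurable fun p : (ℝ × ℝ) × ℝ × ℝ × ℕ => (p.2.1, p.1.1))).mul
        (hφ.comp (by fun_prop : Measurable fun p : (ℝ × ℝ) × ℝ × ℝ × ℕ => (p.2.2.1, p.1.2))))
      measurable_const)
  rw [this, (indepFun_iff_map_prod_eq_prod_map_map (hY i).aemeasurable (hY j).aemeasurable).1
    (hYi.indepFun hij), (hY i).map_eq, (hY j).map_eq]
  refine lintegral_congr fun ω => ?_
  split_ifs
  · exact lintegral_prod_mul (hφ.comp (by fun_prop : Measurable fun y => (τ i ω, y))).aemeasurable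
      (hφ.comp (by fun_prop : Measurable fun y => (τ j ω, y))).aemeasurable
  · simp

lemma lintegral_markedSum_sq_add [SFinite ν] (hYi : iIndepFun Y P) :
    ∫⁻ ω, markedSum τ K Y φ ω ^ 2 ∂P + ∫⁻ s, (∫⁻ y, φ s y ∂ν) ^ 2 ∂(intensity P τ K) =
      ∫⁻ s, (∫⁻ y, φ s.1 y ∂ν) * (∫⁻ y, φ s.2 y ∂ν) ∂(secondMoment P τ K) +
        ∫⁻ s, ∫⁻ y, φ s y ^ 2 ∂ν ∂(intensity P τ K) := by
  have hΦ : Measurable fun s => ∫⁻ y, φ s y ∂ν := hφ.lintegral_prod_right'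
  have hφ2 : Measurable (Function.uncurry fun s y => φ s y ^ 2) := hφ.pow_const 2
  have hΦ2 : Measurable fun s => ∫⁻ y, φ s y ^ 2 ∂ν := hφ2.lintegral_prod_right'
  have hΦΦ : Measurable fun s : ℝ × ℝ => (∫⁻ y, φ s.1 y ∂ν) * ∫⁻ y, φ s.2 y ∂ν :=
    (hΦ.comp measurable_fst).mul (hΦ.comp measurable_snd)
  have hdiag : ∀ b : ℕ → ℝ≥0∞, ∑' i, b i = ∑' p : ℕ × ℕ, if p.1 = p.2 then b p.1 else 0 := by
    intro b
    rw [ENNReal.tsum_prod' ]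
    refine tsum_congr fun i => ?_
    rw [tsum_eq_single i (by intro j hj; simp [hj.symm])]
    simp
  have hsq : ∀ ω, markedSum τ K Y φ ω ^ 2 = ∑' p : ℕ × ℕ,
      if p.1 < K ω ∧ p.2 < K ω then φ (τ p.1 ω) (Y p.1 ω) * φ (τ p.2 ω) (Y p.2 ω) else 0 := by
    intro ω
    rw [sq, ENNReal.tsum_prod', markedSum, ← ENNReal.tsum_mul_right]
    refine tsum_congr fun i => ?_
    rw [← ENNReal.tsum_mul_left]
    refine tsum_congr fun j => ?_
    by_cases h1 : i < K ω <;> by_cases h2 : j < K ω <;> simp [h1, h2]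
  simp_rw [hsq]
  rw [lintegral_tsum, lintegral_intensity hτ hK (hΦ.pow_const 2),
    lintegral_intensity hτ hK hΦ2,
    lintegral_secondMoment hτ hK hΦΦ,
    hdiag, hdiag, ← ENNReal.tsum_add, ← ENNReal.tsum_add]
  · refine tsum_congr fun ⟨i, j⟩ => ?_
    by_cases hij : i = j
    · subst hij
      simp only [and_self, if_true, ← sq]
      rw [lintegral_markedSum_term hτ hK hY hind hφ2, add_comm]
    · simp only [hij, if_false, add_zero]
      exact lintegral_markedSum_pair hτ hK hY hind hφ hYi hij
  · rintro ⟨i, j⟩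
    refine AEMeasurable.congr
      ((aemeasurable_markedSum_term hτ hK (fun i => (hY i).aemeasurable) hφ i).mul
        (aemeasurable_markedSum_term hτ hK (fun i => (hY i).aemeasurable) hφ j))
      (ae_of_all _ fun ω => ?_)
    by_cases h1 : i < K ω <;> by_cases h2 : j < K ω <;> simp [h1, h2]

end MarkedPoints

lemma lintegral_poissonMeasure (r : ℝ≥0) (g : ℕ → ℝ≥0∞) :
    ∫⁻ n, g n ∂(poissonMeasure r) =
      ∑' n, ENNReal.ofReal (Real.exp (-r) * r ^ n / n.factorial) * g n := by
  simp [poissonMeasure, lintegral_sum_measure]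

lemma lintegral_poissonMeasure_cast_mul (r : ℝ≥0) (g : ℕ → ℝ≥0∞) :
    ∫⁻ n, n * g n ∂(poissonMeasure r) = r * ∫⁻ n, g (n + 1) ∂(poissonMeasure r) := by
  rw [lintegral_poissonMeasure, lintegral_poissonMeasure, tsum_eq_zero_add' ENNReal.summable,
    ← ENNReal.tsum_mul_left]
  simp only [Nat.cast_zero, zero_mul, mul_zero, zero_add]
  refine tsum_congr fun n => ?_
  rw [← mul_assoc, ← mul_assoc]
  congr 1
  rw [← ENNReal.ofReal_natCast, ← ENNReal.ofReal_mul (by positivity), ← ENNReal.ofReal_coe_nnreal,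
    ← ENNReal.ofReal_mul (by positivity), Nat.factorial_succ]
  congr 1
  push_cast
  field_simp
  ring

lemma lintegral_cast_poissonMeasure (r : ℝ≥0) : ∫⁻ n : ℕ, n ∂(poissonMeasure r) = r := by
  simpa using lintegral_poissonMeasure_cast_mul r fun _ => 1

lemma lintegral_cast_sq_poissonMeasure (r : ℝ≥0) :
    ∫⁻ n : ℕ, n * n ∂(poissonMeasure r) = r * (r + 1) := by
  rw [lintegral_poissonMeasure_cast_mul r fun n => n]
  simp only [Nat.cast_add, Nat.cast_one]
  rw [lintegral_add_right _ measurable_const, lintegral_cast_poissonMeasure]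
  simp

lemma tsum_ite_lt (n : ℕ) : ∑' i, (if i < n then (1 : ℝ≥0∞) else 0) = n := by
  rw [tsum_eq_sum (s := Finset.range n) (by simp +contextual),
    Finset.sum_congr rfl fun i hi => if_pos (by simpa using hi)]
  simp

section Poisson

variable {Ω : Type*} [MeasurableSpace Ω] {P : Measure Ω}

lemma tsum_measure_lt {M : Ω → ℕ} (hM : Measurable M) :
    ∑' i, P {ω | i < M ω} = ∫⁻ ω, M ω ∂P := by
  have hm : ∀ i, MeasurableSet {ω | i < M ω} := fun i => measurableSet_lt measurable_const hM
  simp_rw [← lintegral_indicator_one (hm _)]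
  rw [← lintegral_tsum fun i => (measurable_one.indicator (hm i)).aemeasurable]
  simp [Set.indicator_apply, tsum_ite_lt]

lemma tsum_measure_lt_and {M L : Ω → ℕ} (hM : Measurable M) (hL : Measurable L) :
    ∑' p : ℕ × ℕ, P {ω | p.1 < M ω ∧ p.2 < L ω} = ∫⁻ ω, M ω * L ω ∂P := by
  have hm : ∀ p : ℕ × ℕ, MeasurableSet {ω | p.1 < M ω ∧ p.2 < L ω} := fun p =>
    (measurableSet_lt measurable_const hM).inter (measurableSet_lt measurable_const hL)
  simp_rw [← lintegral_indicator_one (hm _)]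
  rw [← lintegral_tsum fun i => (measurable_one.indicator (hm i)).aemeasurable]
  refine lintegral_congr fun ω => ?_
  rw [ENNReal.tsum_prod', ← tsum_ite_lt (M ω), ← tsum_ite_lt (L ω), ← ENNReal.tsum_mul_right]
  refine tsum_congr fun i => ?_
  rw [← ENNReal.tsum_mul_left]
  refine tsum_congr fun j => ?_
  by_cases h1 : i < M ω <;> by_cases h2 : j < L ω <;> simp [h1, h2]

variable {T lam : ℝ} {N : ℝ → Ω → ℕ}

omit [MeasurableSpace Ω] in
lemma arrivalTime_nonneg (i : ℕ) (ω : Ω) : 0 ≤ arrivalTime T N i ω :=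
  Real.sInf_nonneg fun _ hs => hs.1.1

namespace IsPoissonProcess

variable (hN : IsPoissonProcess P T lam N)
include hN

lemma arrivalTime_le_iff {i : ℕ} {ω : Ω} (hi : i < N T ω) {s : ℝ} (hs : s ∈ Set.Icc 0 T) :
    arrivalTime T N i ω ≤ s ↔ i < N s ω := by
  have hTm : T ∈ Set.Icc 0 T := ⟨hs.1.trans hs.2, le_rfl⟩
  constructor
  · intro h
    by_contra! hle
    have hc := (hN.rightContinuous ω s hs).eventually (isOpen_discrete {N s ω} |>.mem_nhds rfl)
    obtain ⟨δ, hδ, hball⟩ := Metric.mem_nhdsWithin_iff.1 hc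
    have : s + δ ≤ arrivalTime T N i ω := by
      refine le_csInf ⟨T, hTm, hi⟩ fun u ⟨hu, hiu⟩ => ?_
      by_contra! hlt
      have hsu : s ≤ u := by
        by_contra! hus
        exact absurd (hN.monotone ω hu hs hus.le) (by simpa using hle.trans_lt hiu)
      have : N u ω = N s ω := hball ⟨by
        rw [Metric.mem_ball, Real.dist_eq, abs_of_nonneg (by linarith)]; linarith, hsu, hu.2⟩
      omega
    linarith
  · exact fun h => csInf_le ⟨0, fun _ hu => hu.1.1⟩ ⟨hs, h⟩

lemma arrivalTime_of_le {i : ℕ} {ω : Ω} (hi : N T ω ≤ i) : arrivalTime T N i ω = 0 := by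
  have : {s : ℝ | s ∈ Set.Icc 0 T ∧ i < N s ω} = ∅ := by
    refine Set.eq_empty_of_forall_notMem fun s ⟨hs, his⟩ => ?_
    have := hN.monotone ω hs ⟨hs.1.trans hs.2, le_rfl⟩ hs.2
    simp only at this
    omega
  rw [arrivalTime, this, Real.sInf_empty]

lemma arrivalTime_le_iff_clip (hT : 0 ≤ T) {i : ℕ} {ω : Ω} (hi : i < N T ω) (a : ℝ) :
    arrivalTime T N i ω ≤ a ↔ i < N (max 0 (min a T)) ω := by
  rcases lt_or_ge a 0 with ha | ha
  · rw [max_eq_left (min_le_of_left_le ha.le), hN.zero]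
    simpa using ha.trans_le (arrivalTime_nonneg i ω)
  · have hm : min a T ∈ Set.Icc 0 T := ⟨le_min ha hT, min_le_right _ _⟩
    rw [max_eq_right hm.1, ← hN.arrivalTime_le_iff hi hm, le_min_iff,
      and_iff_left ((hN.arrivalTime_le_iff hi ⟨hT, le_rfl⟩).2 hi)]

lemma measurable_arrivalTime_comap (hT : 0 ≤ T) (i : ℕ) :
    Measurable[MeasurableSpace.comap (fun ω (t : Set.Icc (0 : ℝ) T) => N t ω) inferInstance]
      (arrivalTime T N i) := by
  refine @_root_.measurable_of_Iic ℝ Ω _ _ _ (_) _ _ _ _ fun a => ?_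
  have hm : max 0 (min a T) ∈ Set.Icc 0 T := ⟨le_max_left _ _, max_le hT (min_le_right _ _)⟩
  have : arrivalTime T N i ⁻¹' Set.Iic a =
      (fun ω (t : Set.Icc (0 : ℝ) T) => N t ω) ⁻¹'
        {z | (i < z ⟨T, hT, le_rfl⟩ ∧ i < z ⟨_, hm⟩) ∨ (z ⟨T, hT, le_rfl⟩ ≤ i ∧ 0 ≤ a)} := by
    ext ω
    simp only [Set.mem_preimage, Set.mem_Iic, Set.mem_ofPred_eq]
    rcases lt_or_ge i (N T ω) with hi | hi
    · simp [hN.arrivalTime_le_iff_clip hT hi, hi]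
    · simp [hN.arrivalTime_of_le hi, hi, hi.not_gt]
  rw [this]
  refine ⟨_, ?_, rfl⟩
  exact ((measurableSet_lt measurable_const (measurable_pi_apply _)).inter
    (measurableSet_lt measurable_const (measurable_pi_apply _))).union
    ((measurableSet_le (measurable_pi_apply _) measurable_const).inter (.const _))

lemma comap_le : MeasurableSpace.comap (fun ω (t : Set.Icc (0 : ℝ) T) => N t ω) inferInstance ≤
    ‹MeasurableSpace Ω› :=
  (measurable_pi_lambda _ fun t : Set.Icc (0 : ℝ) T => hN.measurable t t.2).comap_le

lemma measurable_arrivalTime (hT : 0 ≤ T) (i : ℕ) : Measurable (arrivalTime T N i) :=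
  (hN.measurable_arrivalTime_comap hT i).mono hN.comap_le le_rfl

lemma hasLaw {t : ℝ} (ht : t ∈ Set.Icc 0 T) :
    HasLaw (N t) (poissonMeasure (Real.toNNReal (lam * t))) P := by
  simpa [hN.zero] using hN.law_increment 0 ⟨le_rfl, ht.1.trans ht.2⟩ t ht ht.1

lemma lintegral_eval {t : ℝ} (ht : t ∈ Set.Icc 0 T) :
    ∫⁻ ω, N t ω ∂P = ENNReal.ofReal (lam * t) := by
  rw [(hN.hasLaw ht).lintegral_comp (f := fun n : ℕ => (n : ℝ≥0∞)) (by fun_prop),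
    lintegral_cast_poissonMeasure]
  rfl

lemma lintegral_eval_mul (hlam : 0 ≤ lam) {s t : ℝ} (hs : s ∈ Set.Icc 0 T) (ht : t ∈ Set.Icc 0 T)
    (hst : s ≤ t) :
    ∫⁻ ω, N s ω * N t ω ∂P = ENNReal.ofReal (lam * s) * ENNReal.ofReal (lam * t) +
      ENNReal.ofReal (lam * s) := by
  have h0 : (0 : ℝ) ∈ Set.Icc 0 T := ⟨le_rfl, hs.1.trans hs.2⟩
  have hm : Measurable fun n : ℕ => (n : ℝ≥0∞) := by fun_prop
  have hind : IndepFun (fun ω => (N s ω : ℝ≥0∞)) (fun ω => ((N t ω - N s ω : ℕ) : ℝ≥0∞)) P := by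
    have := hN.indepIncrements.indepFun_sub_sub (r := ⟨0, h0⟩) (s := ⟨s, hs⟩) (t := ⟨t, ht⟩)
      hs.1 hst
    have := this.comp hm hm
    simpa [Function.comp_def, hN.zero] using this
  have hdecomp : ∀ ω, (N s ω * N t ω : ℝ≥0∞) =
      N s ω * N s ω + N s ω * ((N t ω - N s ω : ℕ) : ℝ≥0∞) := by
    intro ω
    have := hN.monotone ω hs ht hst
    simp only at this
    rw [← mul_add, ← Nat.cast_add, Nat.add_sub_cancel' this]
  have hms : Measurable fun ω => (N s ω : ℝ≥0∞) := hm.comp (hN.measurable s hs)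
  have hmd : Measurable fun ω => ((N t ω - N s ω : ℕ) : ℝ≥0∞) :=
    hm.comp ((hN.measurable t ht).sub (hN.measurable s hs))
  simp_rw [hdecomp]
  have hms2 : Measurable fun ω => (N s ω : ℝ≥0∞) * N s ω := hms.mul hms
  rw [lintegral_add_left hms2,
    lintegral_mul_eq_lintegral_mul_lintegral_of_indepFun'' hms.aemeasurable hmd.aemeasurable hind,
    (hN.hasLaw hs).lintegral_comp (f := fun n : ℕ => (n * n : ℝ≥0∞)) (by fun_prop),
    lintegral_cast_sq_poissonMeasure, hN.lintegral_eval hs,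
    (hN.law_increment s hs t ht hst).lintegral_comp (f := fun n : ℕ => (n : ℝ≥0∞)) (by fun_prop),
    lintegral_cast_poissonMeasure]
  change ENNReal.ofReal (lam * s) * (ENNReal.ofReal (lam * s) + 1) +
    ENNReal.ofReal (lam * s) * ENNReal.ofReal (lam * (t - s)) = _
  rw [mul_add, mul_one, add_right_comm, ← mul_add, ← ENNReal.ofReal_add
    (mul_nonneg hlam hs.1) (mul_nonneg hlam (sub_nonneg.2 hst))]
  ring_nf

end IsPoissonProcess

/-- Lebesgue measure on `(0, T]` times the intensity `lam`. -/
noncomputable def rateMeasure (T lam : ℝ) : Measure ℝ :=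
  ENNReal.ofReal lam • volume.restrict (Set.Ioc 0 T)

instance (T lam : ℝ) : IsFiniteMeasure (rateMeasure T lam) := by
  unfold rateMeasure
  exact Measure.smul_finite _ ENNReal.ofReal_ne_top

lemma rateMeasure_Iic (hlam : 0 ≤ lam) (a : ℝ) :
    rateMeasure T lam (Set.Iic a) = ENNReal.ofReal (lam * max 0 (min a T)) := by
  have : Set.Iic a ∩ Set.Ioc 0 T = Set.Ioc 0 (min a T) := by
    ext; simp; tauto
  rw [rateMeasure, Measure.smul_apply, Measure.restrict_apply measurableSet_Iic, this,
    Real.volume_Ioc, smul_eq_mul, ← ENNReal.ofReal_mul hlam, sub_zero]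
  rcases le_total 0 (min a T) with h | h
  · rw [max_eq_right h]
  · rw [max_eq_left h, ENNReal.ofReal_of_nonpos (mul_nonpos_of_nonneg_of_nonpos hlam h)]
    simp

namespace IsPoissonProcess

variable (hN : IsPoissonProcess P T lam N) (hT : 0 ≤ T) (hlam : 0 ≤ lam)
include hN hT hlam

lemma intensity_Iic (a : ℝ) :
    intensity P (arrivalTime T N) (N T) (Set.Iic a) = rateMeasure T lam (Set.Iic a) := by
  have hm : max 0 (min a T) ∈ Set.Icc 0 T := ⟨le_max_left _ _, max_le hT (min_le_right _ _)⟩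
  rw [intensity, Measure.sum_apply _ measurableSet_Iic, rateMeasure_Iic hlam,
    ← hN.lintegral_eval hm, ← tsum_measure_lt (hN.measurable _ hm)]
  refine tsum_congr fun i => ?_
  rw [Measure.map_apply (hN.measurable_arrivalTime hT i) measurableSet_Iic,
    Measure.restrict_apply (hN.measurable_arrivalTime hT i measurableSet_Iic)]
  congr 1
  ext ω
  simp only [Set.mem_inter_iff, Set.mem_preimage, Set.mem_Iic, Set.mem_ofPred_eq]
  have hmono := hN.monotone ω hm ⟨hT, le_rfl⟩ hm.2
  simp only at hmono
  constructor
  · exact fun h => (hN.arrivalTime_le_iff_clip hT h.2 a).1 h.1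
  · exact fun h => ⟨(hN.arrivalTime_le_iff_clip hT (h.trans_le hmono) a).2 h, h.trans_le hmono⟩

lemma intensity_eq : intensity P (arrivalTime T N) (N T) = rateMeasure T lam :=
  (Measure.ext_of_Iic _ _ fun a => (hN.intensity_Iic hT hlam a).symm).symm

omit hlam in
lemma secondMoment_Iic_prod (a b : ℝ) :
    secondMoment P (arrivalTime T N) (N T) (Set.Iic a ×ˢ Set.Iic b) =
      ∫⁻ ω, N (max 0 (min a T)) ω * N (max 0 (min b T)) ω ∂P := by
  have hm : ∀ a : ℝ, max 0 (min a T) ∈ Set.Icc 0 T :=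
    fun a => ⟨le_max_left _ _, max_le hT (min_le_right _ _)⟩
  have hmeas : MeasurableSet (Set.Iic a ×ˢ Set.Iic b) := measurableSet_Iic.prod measurableSet_Iic
  have hτ := fun p : ℕ × ℕ =>
    (hN.measurable_arrivalTime hT p.1).prodMk (hN.measurable_arrivalTime hT p.2)
  rw [secondMoment, Measure.sum_apply _ hmeas,
    ← tsum_measure_lt_and (hN.measurable _ (hm a)) (hN.measurable _ (hm b))]
  refine tsum_congr fun p => ?_
  rw [Measure.map_apply (hτ p) hmeas, Measure.restrict_apply (hτ p hmeas)]
  congr 1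
  ext ω
  simp only [Set.mem_inter_iff, Set.mem_preimage, Set.mem_prod, Set.mem_Iic, Set.mem_ofPred_eq]
  have ha := hN.monotone ω (hm a) ⟨hT, le_rfl⟩ (hm a).2
  have hb := hN.monotone ω (hm b) ⟨hT, le_rfl⟩ (hm b).2
  simp only at ha hb
  constructor
  · exact fun ⟨⟨h1, h2⟩, h3, h4⟩ =>
      ⟨(hN.arrivalTime_le_iff_clip hT h3 a).1 h1, (hN.arrivalTime_le_iff_clip hT h4 b).1 h2⟩
  · exact fun ⟨h1, h2⟩ => ⟨⟨(hN.arrivalTime_le_iff_clip hT (h1.trans_le ha) a).2 h1,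
      (hN.arrivalTime_le_iff_clip hT (h2.trans_le hb) b).2 h2⟩, h1.trans_le ha, h2.trans_le hb⟩

lemma secondMoment_eq : secondMoment P (arrivalTime T N) (N T) =
    (rateMeasure T lam).prod (rateMeasure T lam) +
      (rateMeasure T lam).map fun s => (s, s) := by
  have hdiag : Measurable fun s : ℝ => (s, s) := by fun_prop
  have hIic : ∀ a b, secondMoment P (arrivalTime T N) (N T) (Set.Iic a ×ˢ Set.Iic b) =
      ((rateMeasure T lam).prod (rateMeasure T lam) +
        (rateMeasure T lam).map fun s => (s, s)) (Set.Iic a ×ˢ Set.Iic b) := by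
    intro a b
    have hm : ∀ a : ℝ, max 0 (min a T) ∈ Set.Icc 0 T :=
      fun a => ⟨le_max_left _ _, max_le hT (min_le_right _ _)⟩
    have hpre : (fun s : ℝ => (s, s)) ⁻¹' (Set.Iic a ×ˢ Set.Iic b) = Set.Iic (min a b) := by
      ext; simp
    rw [hN.secondMoment_Iic_prod hT, Measure.add_apply, Measure.prod_prod,
      Measure.map_apply hdiag (measurableSet_Iic.prod measurableSet_Iic), hpre,
      rateMeasure_Iic hlam, rateMeasure_Iic hlam, rateMeasure_Iic hlam]
    rcases le_total a b with h | h
    · rw [hN.lintegral_eval_mul hlam (hm a) (hm b) (by gcongr), min_eq_left h]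
    · simp_rw [mul_comm (N (max 0 (min a T)) _ : ℝ≥0∞)]
      rw [hN.lintegral_eval_mul hlam (hm b) (hm a) (by gcongr), min_eq_right h, mul_comm]
  have huniv : secondMoment P (arrivalTime T N) (N T) Set.univ =
      ((rateMeasure T lam).prod (rateMeasure T lam) +
        (rateMeasure T lam).map fun s => (s, s)) Set.univ := by
    have hmono : Monotone fun n : ℕ => Set.Iic (n : ℝ) ×ˢ Set.Iic (n : ℝ) := fun m n hmn => by
      have : (m : ℝ) ≤ n := by exact_mod_cast hmn
      exact Set.prod_mono (Set.Iic_subset_Iic.2 this) (Set.Iic_subset_Iic.2 this)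
    have hU : (⋃ n : ℕ, Set.Iic (n : ℝ) ×ˢ Set.Iic (n : ℝ)) = Set.univ := by
      refine Set.eq_univ_of_forall fun p => Set.mem_iUnion.2 ?_
      obtain ⟨n, hn⟩ := exists_nat_ge (max p.1 p.2)
      exact ⟨n, (le_max_left _ _).trans hn, (le_max_right _ _).trans hn⟩
    rw [← hU, hmono.measure_iUnion, hmono.measure_iUnion]
    simp_rw [hIic]
  symm
  refine ext_of_generate_finite (Set.image2 (· ×ˢ ·) (Set.range Set.Iic) (Set.range Set.Iic)) ?_
    (isPiSystem_Iic.prod isPiSystem_Iic) ?_ huniv.symm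
  · have hb : MeasurableSpace.generateFrom (Set.range Set.Iic) = (inferInstance : MeasurableSpace ℝ) := by
      rw [← borel_eq_generateFrom_Iic ℝ]; exact (BorelSpace.measurable_eq).symm
    have hs : IsCountablySpanning (Set.range (Set.Iic : ℝ → Set ℝ)) :=
      ⟨fun n : ℕ => Set.Iic (n : ℝ), fun n => ⟨n, rfl⟩, by
        refine Set.eq_univ_of_forall fun p => Set.mem_iUnion.2 ?_
        exact exists_nat_ge p⟩
    exact (generateFrom_eq_prod hb hb hs hs).symm
  · rintro _ ⟨_, ⟨a, rfl⟩, _, ⟨b, rfl⟩, rfl⟩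
    exact (hIic a b).symm

end IsPoissonProcess

end Poisson

section Moments

variable {Ω : Type*} [MeasurableSpace Ω] {P : Measure Ω} [IsProbabilityMeasure P]

lemma moments_toReal {W : Ω → ℝ≥0∞} (hW : AEMeasurable W P) {m v : ℝ}
    (hm : 0 ≤ m) (hv : 0 ≤ v) (h1 : ∫⁻ ω, W ω ∂P = ENNReal.ofReal m)
    (h2 : ∫⁻ ω, W ω ^ 2 ∂P = ENNReal.ofReal (m ^ 2 + v)) :
    MemLp (fun ω => (W ω).toReal) 2 P ∧ ∫ ω, (W ω).toReal ∂P = m ∧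
      variance (fun ω => (W ω).toReal) P = v := by
  have hfin : ∀ᵐ ω ∂P, W ω < ∞ := ae_lt_top' hW (by simp [h1])
  have hint : Integrable (fun ω => (W ω ^ 2).toReal) P :=
    integrable_toReal_of_lintegral_ne_top (hW.pow_const 2) (by simp [h2])
  have hmem : MemLp (fun ω => (W ω).toReal) 2 P := by
    rw [memLp_two_iff_integrable_sq hW.ennreal_toReal.aestronglyMeasurable]
    simpa using hint
  have hmean : ∫ ω, (W ω).toReal ∂P = m := by
    rw [integral_toReal hW hfin, h1, ENNReal.toReal_ofReal hm]
  refine ⟨hmem, hmean, ?_⟩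
  have hsq : ∫ ω, (W ω).toReal ^ 2 ∂P = m ^ 2 + v := by
    simp_rw [← ENNReal.toReal_pow]
    rw [integral_toReal (hW.pow_const 2) (hfin.mono fun ω h => ENNReal.pow_lt_top h), h2,
      ENNReal.toReal_ofReal (by positivity)]
  rw [variance_eq_sub hmem, hmean]
  simp only [Pi.pow_apply]
  rw [hsq]
  ring

end Moments

/-- The law of a claim size with density `g` on `(0, ∞)`. -/
noncomputable def claimLaw (g : ℝ → ℝ) : Measure ℝ :=
  (volume.restrict (Set.Ioi (0 : ℝ))).withDensity fun y => ENNReal.ofReal (g y)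

/-- The part of `k` on `(t, T]` with values in the extended nonnegative reals. -/
noncomputable def restrictTime (T t : ℝ) (k : ℝ → ℝ → ℝ) (s y : ℝ) : ℝ≥0∞ :=
  (Set.Ioc t T).indicator (fun s => ENNReal.ofReal (k s y)) s

lemma measurable_restrictTime {T t : ℝ} {k : ℝ → ℝ → ℝ} (hk : Measurable (Function.uncurry k)) :
    Measurable (Function.uncurry (restrictTime T t k)) := by
  have := hk.ennreal_ofReal.indicator (measurable_fst (measurableSet_Ioc (a := t) (b := T)))
  exact this

section Integrals

variable {T t lam : ℝ} {g C : ℝ → ℝ} {k : ℝ → ℝ → ℝ}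

lemma integrableOn_mul_of_le (hg : Measurable g) (hg0 : ∀ y, 0 < y → 0 ≤ g y)
    (hC : IntegrableOn (fun y => C y * g y) (Set.Ioi 0)) {u : ℝ → ℝ} (hu : Measurable u)
    (hu0 : ∀ y, 0 < y → 0 ≤ u y ∧ u y ≤ C y) :
    IntegrableOn (fun y => u y * g y) (Set.Ioi 0) := by
  refine Integrable.mono' hC (hu.mul hg).aestronglyMeasurable ?_
  filter_upwards [ae_restrict_mem measurableSet_Ioi] with y hy
  rw [Real.norm_of_nonneg (mul_nonneg (hu0 y hy).1 (hg0 y hy))]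
  exact mul_le_mul_of_nonneg_right (hu0 y hy).2 (hg0 y hy)

variable (hg : Measurable g) (hg0 : ∀ y, 0 < y → 0 ≤ g y)
  (hC : IntegrableOn (fun y => C y * g y) (Set.Ioi 0)) (hk : Measurable (Function.uncurry k))
  (hk0 : ∀ s ∈ Set.Icc 0 T, ∀ y, 0 < y → 0 ≤ k s y ∧ k s y ≤ C y) (ht : t ∈ Set.Icc 0 T)

include hg0 hk0 in
lemma setIntegral_mul_nonneg {s : ℝ} (hs : s ∈ Set.Icc 0 T) :
    0 ≤ ∫ y in Set.Ioi (0 : ℝ), k s y * g y :=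
  setIntegral_nonneg measurableSet_Ioi fun y hy => mul_nonneg (hk0 s hs y hy).1 (hg0 y hy)

include hg hg0 hC hk hk0

lemma setIntegral_mul_le {s : ℝ} (hs : s ∈ Set.Icc 0 T) :
    ∫ y in Set.Ioi (0 : ℝ), k s y * g y ≤ ∫ y in Set.Ioi (0 : ℝ), C y * g y :=
  setIntegral_mono_on (integrableOn_mul_of_le hg hg0 hC hk.of_uncurry_left (hk0 s hs)) hC
    measurableSet_Ioi fun y hy => mul_le_mul_of_nonneg_right (hk0 s hs y hy).2 (hg0 y hy)

include ht

lemma integrableOn_setIntegral_mul :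
    IntegrableOn (fun s => ∫ y in Set.Ioi (0 : ℝ), k s y * g y) (Set.Ioc t T) := by
  have hm : StronglyMeasurable fun s => ∫ y in Set.Ioi (0 : ℝ), k s y * g y :=
    StronglyMeasurable.integral_prod_right (f := fun s y => k s y * g y)
      (hk.mul (hg.comp measurable_snd)).stronglyMeasurable
  refine Measure.integrableOn_of_bounded (M := ∫ y in Set.Ioi (0 : ℝ), C y * g y)
    (by simp) hm.aestronglyMeasurable ?_
  filter_upwards [ae_restrict_mem measurableSet_Ioc] with s hs
  have hs' : s ∈ Set.Icc 0 T := ⟨ht.1.trans hs.1.le, hs.2⟩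
  rw [Real.norm_of_nonneg (setIntegral_mul_nonneg hg0 hk0 hs')]
  exact setIntegral_mul_le hg hg0 hC hk hk0 hs'

lemma lintegral_restrictTime_claimLaw (s : ℝ) :
    ∫⁻ y, restrictTime T t k s y ∂(claimLaw g) = (Set.Ioc t T).indicator
      (fun s => ENNReal.ofReal (∫ y in Set.Ioi (0 : ℝ), k s y * g y)) s := by
  by_cases hs : s ∈ Set.Ioc t T
  · have hs' : s ∈ Set.Icc 0 T := ⟨ht.1.trans hs.1.le, hs.2⟩
    simp only [restrictTime, Set.indicator_of_mem hs]
    have hks : Measurable (k s) := hk.of_uncurry_left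
    rw [claimLaw, lintegral_withDensity_eq_lintegral_mul _ hg.ennreal_ofReal hks.ennreal_ofReal,
      ofReal_integral_eq_lintegral_ofReal
        (integrableOn_mul_of_le hg hg0 hC hks (hk0 s hs'))]
    · refine setLIntegral_congr_fun measurableSet_Ioi fun y hy => ?_
      simp only [Pi.mul_apply]
      rw [mul_comm, ENNReal.ofReal_mul (hk0 s hs' y hy).1]
    · filter_upwards [ae_restrict_mem measurableSet_Ioi] with y hy
      exact mul_nonneg (hk0 s hs' y hy).1 (hg0 y hy)
  · simp [restrictTime, hs]

lemma lintegral_restrictTime (hlam : 0 ≤ lam) :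
    ∫⁻ s, ∫⁻ y, restrictTime T t k s y ∂(claimLaw g) ∂(rateMeasure T lam) =
      ENNReal.ofReal (lam * ∫ s in t..T, ∫ y in Set.Ioi (0 : ℝ), k s y * g y) := by
  simp_rw [lintegral_restrictTime_claimLaw hg hg0 hC hk hk0 ht]
  have hint := integrableOn_setIntegral_mul hg hg0 hC hk hk0 ht
  rw [rateMeasure, lintegral_smul_measure, lintegral_indicator measurableSet_Ioc,
    Measure.restrict_restrict measurableSet_Ioc, Set.inter_eq_left.2 (Set.Ioc_subset_Ioc_left ht.1),
    intervalIntegral.integral_of_le ht.2, ENNReal.ofReal_mul hlam,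
    ofReal_integral_eq_lintegral_ofReal hint]
  · rfl
  · filter_upwards [ae_restrict_mem measurableSet_Ioc] with s hs
    exact setIntegral_mul_nonneg hg0 hk0 ⟨ht.1.trans hs.1.le, hs.2⟩

lemma lintegral_sq_restrictTime_ne_top :
    ∫⁻ s, (∫⁻ y, restrictTime T t k s y ∂(claimLaw g)) ^ 2 ∂(rateMeasure T lam) ≠ ∞ := by
  refine ne_top_of_le_ne_top (b := ∫⁻ _, ENNReal.ofReal (∫ y in Set.Ioi (0 : ℝ), C y * g y) ^ 2
    ∂(rateMeasure T lam)) ?_ (lintegral_mono fun s => ?_)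
  · rw [lintegral_const]
    exact ENNReal.mul_ne_top (by simp) (measure_ne_top _ _)
  · rw [lintegral_restrictTime_claimLaw hg hg0 hC hk hk0 ht]
    gcongr
    by_cases hs : s ∈ Set.Ioc t T
    · rw [Set.indicator_of_mem hs]
      exact ENNReal.ofReal_le_ofReal
        (setIntegral_mul_le hg hg0 hC hk hk0 ⟨ht.1.trans hs.1.le, hs.2⟩)
    · simp [hs]

end Integrals

section Claims

variable {Ω : Type*} [MeasurableSpace Ω] {P : Measure Ω}
  {T lam : ℝ} {g : ℝ → ℝ} {N : ℝ → Ω → ℕ} {Y : ℕ → Ω → ℝ}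

namespace IsClaimModel

variable (hM : IsClaimModel P T lam g N Y)
include hM

lemma indepFun_arrivalTime (hT : 0 ≤ T) : IndepFun (fun ω i => Y i ω)
    (fun ω => (fun i => arrivalTime T N i ω, N T ω)) P := by
  have h := hM.indep_arrivals
  rw [IndepFun_iff_Indep] at h ⊢
  refine indep_of_indep_of_le_right h ?_
  refine @Measurable.comap_le _ _ (MeasurableSpace.comap _ _) _ _ ?_
  refine @Measurable.prodMk _ _ _ _ _ (_) _ _ ?_ ?_
  · exact @measurable_pi_lambda _ _ _ (_) _ _ fun i => hM.poisson.measurable_arrivalTime_comap hT i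
  · exact (measurable_pi_apply (⟨T, hT, le_rfl⟩ : Set.Icc (0 : ℝ) T)).comp
      (comap_measurable fun ω (t : Set.Icc (0 : ℝ) T) => N t ω)

lemma ae_pos : ∀ᵐ ω ∂P, ∀ i, 0 < Y i ω := by
  refine ae_all_iff.2 fun i => ?_
  refine ((hM.law_claim i).ae_iff (p := fun y => 0 < y) (measurable_const.lt measurable_id)).2 ?_
  exact (withDensity_absolutelyContinuous _ _).ae_le (ae_restrict_mem measurableSet_Ioi)

lemma jumpIntegral_ae_eq {k : ℝ → ℝ → ℝ}
    (hk0 : ∀ s ∈ Set.Icc 0 T, ∀ y, 0 < y → 0 ≤ k s y) {t : ℝ} (ht : t ∈ Set.Icc 0 T) :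
    jumpIntegral T N Y k t T =ᵐ[P] fun ω =>
      (markedSum (arrivalTime T N) (N T) Y (restrictTime T t k) ω).toReal := by
  have hT : 0 ≤ T := ht.1.trans ht.2
  filter_upwards [hM.ae_pos] with ω hω
  rw [markedSum_eq_sum, ENNReal.toReal_sum (by
    intro i _; unfold restrictTime Set.indicator; split_ifs <;> simp), jumpIntegral]
  have hsub : Finset.Ico (N t ω) (N T ω) ⊆ Finset.range (N T ω) := fun i hi => by
    simp at hi ⊢; omega
  have hle : ∀ i, i < N T ω → arrivalTime T N i ω ≤ T := fun i hi =>
    (hM.poisson.arrivalTime_le_iff hi ⟨hT, le_rfl⟩).2 hi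
  rw [← Finset.sum_subset hsub]
  · refine Finset.sum_congr rfl fun i hi => ?_
    simp only [Finset.mem_Ico] at hi
    have hmem : arrivalTime T N i ω ∈ Set.Ioc t T :=
      ⟨not_le.1 fun h => by
        have := (hM.poisson.arrivalTime_le_iff hi.2 ht).1 h; omega, hle i hi.2⟩
    rw [restrictTime, Set.indicator_of_mem hmem, ENNReal.toReal_ofReal
      (hk0 _ ⟨arrivalTime_nonneg _ _, hmem.2⟩ _ (hω i))]
  · intro i hi hi'
    simp only [Finset.mem_range, Finset.mem_Ico, not_and, not_lt] at hi hi'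
    have : arrivalTime T N i ω ≤ t :=
      (hM.poisson.arrivalTime_le_iff hi ht).2 (by by_contra! h; have := hi' h; omega)
    rw [restrictTime, Set.indicator_of_notMem (fun h => not_lt.2 this h.1)]
    rfl

/-- Campbell's formulas for the mean and the variance of a sum over the claims. -/
lemma moments_jumpIntegral [IsProbabilityMeasure P] (hlam : 0 ≤ lam) (hg : IsClaimDensity g)
    {k : ℝ → ℝ → ℝ} (hk : Measurable (Function.uncurry k))
    (hk0 : ∀ s ∈ Set.Icc 0 T, ∀ y, 0 < y → 0 ≤ k s y ∧ k s y ≤ y)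
    {t : ℝ} (ht : t ∈ Set.Icc 0 T) :
    MemLp (jumpIntegral T N Y k t T) 2 P ∧
      ∫ ω, jumpIntegral T N Y k t T ω ∂P =
        lam * ∫ s in t..T, ∫ y in Set.Ioi (0 : ℝ), k s y * g y ∧
      variance (jumpIntegral T N Y k t T) P =
        lam * ∫ s in t..T, ∫ y in Set.Ioi (0 : ℝ), k s y ^ 2 * g y := by
  have hT : 0 ≤ T := ht.1.trans ht.2
  have hN := hM.poisson
  have hτ := hN.measurable_arrivalTime hT
  have hK := hN.measurable T ⟨hT, le_rfl⟩
  have hφ := measurable_restrictTime (T := T) (t := t) hk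
  have hk2 : Measurable (Function.uncurry fun s y => k s y ^ 2) := hk.pow_const 2
  have hk20 : ∀ s ∈ Set.Icc 0 T, ∀ y, 0 < y → 0 ≤ k s y ^ 2 ∧ k s y ^ 2 ≤ y ^ 2 :=
    fun s hs y hy => ⟨sq_nonneg _, pow_le_pow_left₀ (hk0 s hs y hy).1 (hk0 s hs y hy).2 2⟩
  have hY : ∀ i, HasLaw (Y i) (claimLaw g) P := hM.law_claim
  have : SFinite (claimLaw g) := by unfold claimLaw; infer_instance
  have hΦ : Measurable fun s => ∫⁻ y, restrictTime T t k s y ∂(claimLaw g) :=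
    hφ.lintegral_prod_right'
  have hnn : ∀ k' : ℝ → ℝ → ℝ, (∀ s ∈ Set.Icc 0 T, ∀ y, 0 < y → 0 ≤ k' s y) →
      0 ≤ lam * ∫ s in t..T, ∫ y in Set.Ioi (0 : ℝ), k' s y * g y := fun k' hk' =>
    mul_nonneg hlam (intervalIntegral.integral_nonneg ht.2 fun s hs =>
      setIntegral_nonneg measurableSet_Ioi fun y hy =>
        mul_nonneg (hk' s ⟨ht.1.trans hs.1, hs.2⟩ y hy) (hg.nonneg y hy))
  have h1 := lintegral_markedSum hτ hK hY (hM.indepFun_arrivalTime hT) hφ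
  rw [hN.intensity_eq hT hlam, lintegral_restrictTime hg.measurable hg.nonneg hg.integrable_mul
    hk hk0 ht hlam] at h1
  have h2 := lintegral_markedSum_sq_add hτ hK hY (hM.indepFun_arrivalTime hT) hφ hM.indep_claims
  have hpos : ∀ᵐ y ∂(claimLaw g), 0 < y :=
    (withDensity_absolutelyContinuous _ _).ae_le (ae_restrict_mem measurableSet_Ioi)
  have hsq : ∀ s, ∫⁻ y, restrictTime T t k s y ^ 2 ∂(claimLaw g) =
      ∫⁻ y, restrictTime T t (fun s y => k s y ^ 2) s y ∂(claimLaw g) := by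
    intro s
    refine lintegral_congr_ae (hpos.mono fun y hy => ?_)
    by_cases hs : s ∈ Set.Ioc t T
    · simp only [restrictTime, Set.indicator_of_mem hs]
      rw [ENNReal.ofReal_pow (hk0 s ⟨ht.1.trans hs.1.le, hs.2⟩ y hy).1]
    · simp [restrictTime, hs]
  have hΦΦ : Measurable fun s : ℝ × ℝ => (∫⁻ y, restrictTime T t k s.1 y ∂(claimLaw g)) *
      ∫⁻ y, restrictTime T t k s.2 y ∂(claimLaw g) :=
    (hΦ.comp measurable_fst).mul (hΦ.comp measurable_snd)
  simp_rw [hsq] at h2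
  rw [hN.secondMoment_eq hT hlam, hN.intensity_eq hT hlam,
    lintegral_restrictTime hg.measurable hg.nonneg hg.integrable_sq_mul hk2 hk20 ht hlam,
    lintegral_add_measure, lintegral_prod_mul hΦ.aemeasurable hΦ.aemeasurable,
    lintegral_map hΦΦ (by fun_prop),
    lintegral_restrictTime hg.measurable hg.nonneg hg.integrable_mul hk hk0 ht hlam] at h2
  have hm1 := hnn k fun s hs y hy => (hk0 s hs y hy).1
  have hm2 := hnn (fun s y => k s y ^ 2) fun s _ y _ => sq_nonneg _
  have h2' : ∫⁻ ω, markedSum (arrivalTime T N) (N T) Y (restrictTime T t k) ω ^ 2 ∂P =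
      ENNReal.ofReal ((lam * ∫ s in t..T, ∫ y in Set.Ioi (0 : ℝ), k s y * g y) ^ 2 +
        lam * ∫ s in t..T, ∫ y in Set.Ioi (0 : ℝ), k s y ^ 2 * g y) := by
    refine (ENNReal.add_left_inj (lintegral_sq_restrictTime_ne_top (lam := lam) hg.measurable
      hg.nonneg hg.integrable_mul hk hk0 ht)).1 (h2.trans ?_)
    rw [ENNReal.ofReal_add (by positivity) hm2, ENNReal.ofReal_pow hm1]
    simp_rw [sq]
    rw [add_right_comm]
  have hae := hM.jumpIntegral_ae_eq (fun s hs y hy => (hk0 s hs y hy).1) ht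
  obtain ⟨hmem, hmean, hvar⟩ := moments_toReal
    (aemeasurable_markedSum hτ hK (fun i => (hY i).aemeasurable) hφ) hm1 hm2 h1 h2'
  exact ⟨(memLp_congr_ae hae).2 hmem, (integral_congr_ae hae).trans hmean,
    (variance_congr hae).trans hvar⟩

end IsClaimModel

end Claims

/-- The customer's cost rate per unit of claim intensity under the coverage `u` of a single claim:
loaded premium, expected retained loss, and penalty for its second moment. -/
noncomputable def costRate (ξ a : ℝ) (gt g : ℝ → ℝ) (u : ℝ → ℝ) : ℝ :=
  (∫ y in Set.Ioi (0 : ℝ), (1 + ξ) * u y * gt y) +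
    ∫ y in Set.Ioi (0 : ℝ), ((y - u y) + a / 2 * (y - u y) ^ 2) * g y

lemma integrableOn_premium {gt : ℝ → ℝ} (hgt : IsClaimDensity gt) (ξ : ℝ) {u : ℝ → ℝ}
    (hu : Measurable u) (hu0 : ∀ y, 0 ≤ y → 0 ≤ u y ∧ u y ≤ y) :
    IntegrableOn (fun y => (1 + ξ) * u y * gt y) (Set.Ioi 0) := by
  have := (integrableOn_mul_of_le hgt.measurable hgt.nonneg hgt.integrable_mul hu
    fun y hy => hu0 y hy.le).const_mul (1 + ξ)
  refine this.congr (ae_of_all _ fun y => ?_)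
  simp only [mul_assoc]

lemma integrableOn_retained {g : ℝ → ℝ} (hg : IsClaimDensity g) {u : ℝ → ℝ}
    (hu : Measurable u) (hu0 : ∀ y, 0 ≤ y → 0 ≤ u y ∧ u y ≤ y) :
    IntegrableOn (fun y => (y - u y) * g y) (Set.Ioi 0) :=
  integrableOn_mul_of_le hg.measurable hg.nonneg hg.integrable_mul (measurable_id.sub hu)
    fun y hy => by have := hu0 y hy.le; simp; exact ⟨this.2, this.1⟩

lemma integrableOn_sq_retained {g : ℝ → ℝ} (hg : IsClaimDensity g) {u : ℝ → ℝ}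
    (hu : Measurable u) (hu0 : ∀ y, 0 ≤ y → 0 ≤ u y ∧ u y ≤ y) :
    IntegrableOn (fun y => (y - u y) ^ 2 * g y) (Set.Ioi 0) :=
  integrableOn_mul_of_le hg.measurable hg.nonneg hg.integrable_sq_mul
    ((measurable_id.sub hu).pow_const 2) fun y hy => by
      have := hu0 y hy.le
      exact ⟨sq_nonneg _, pow_le_pow_left₀ (by linarith) (by linarith) 2⟩

lemma integrableOn_retained_add {g : ℝ → ℝ} (hg : IsClaimDensity g) (a : ℝ) {u : ℝ → ℝ}
    (hu : Measurable u) (hu0 : ∀ y, 0 ≤ y → 0 ≤ u y ∧ u y ≤ y) :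
    IntegrableOn (fun y => ((y - u y) + a / 2 * (y - u y) ^ 2) * g y) (Set.Ioi 0) := by
  have := (integrableOn_retained hg hu hu0).add
    ((integrableOn_sq_retained hg hu hu0).const_mul (a / 2))
  refine this.congr (ae_of_all _ fun y => ?_)
  simp only [Pi.add_apply]
  ring

lemma costRate_eq {gt g : ℝ → ℝ} (hg : IsClaimDensity g) (ξ a : ℝ) {u : ℝ → ℝ}
    (hu : Measurable u) (hu0 : ∀ y, 0 ≤ y → 0 ≤ u y ∧ u y ≤ y) :
    costRate ξ a gt g u = (1 + ξ) * (∫ y in Set.Ioi (0 : ℝ), u y * gt y) +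
      ((∫ y in Set.Ioi (0 : ℝ), (y - u y) * g y) +
        a / 2 * ∫ y in Set.Ioi (0 : ℝ), (y - u y) ^ 2 * g y) := by
  rw [costRate, ← integral_const_mul, ← integral_const_mul, ← integral_add
    (integrableOn_retained hg hu hu0) ((integrableOn_sq_retained hg hu hu0).const_mul _)]
  congr 2 <;> ext y <;> ring

lemma measurable_optimalCoverage {ξ a : ℝ} {gt g : ℝ → ℝ} (hgt : Measurable gt)
    (hg : Measurable g) : Measurable (optimalCoverage ξ a gt g) := by
  unfold optimalCoverage
  exact Measurable.ite (hg (measurableSet_singleton 0)) (by fun_prop) (by fun_prop)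

lemma optimalCoverage_mem {ξ a : ℝ} {gt g : ℝ → ℝ} {y : ℝ} (hy : 0 ≤ y) :
    0 ≤ optimalCoverage ξ a gt g y ∧ optimalCoverage ξ a gt g y ≤ y := by
  unfold optimalCoverage
  split_ifs
  · exact ⟨le_min le_rfl hy, min_le_right _ _⟩
  · exact ⟨le_min (le_max_right _ _) hy, min_le_right _ _⟩

lemma admissible_optimalCoverage {ξ a T : ℝ} {gt g : ℝ → ℝ} (hgt : Measurable gt)
    (hg : Measurable g) : Admissible T fun _ y => optimalCoverage ξ a gt g y :=
  ⟨(measurable_optimalCoverage hgt hg).comp measurable_snd, fun _ _ _ hy => optimalCoverage_mem hy⟩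

lemma sq_clip_sub_le {u v y : ℝ} (h0 : 0 ≤ u) (hy : u ≤ y) :
    (min (max v 0) y - v) ^ 2 ≤ (u - v) ^ 2 := by
  rw [sq_le_sq]
  rcases le_total v 0 with hv | hv
  · rw [max_eq_right hv, min_eq_left (h0.trans hy), abs_of_nonneg (by linarith),
      abs_of_nonneg (by linarith)]
    linarith
  · rw [max_eq_left hv]
    rcases le_total v y with hvy | hvy
    · simp [min_eq_left hvy]
    · rw [min_eq_right hvy, abs_of_nonpos (by linarith), abs_of_nonpos (by linarith)]
      linarith

lemma optimalCoverage_pointwise_le {ξ a : ℝ} (hξ : 0 ≤ ξ) (ha : 0 < a) {gt g : ℝ → ℝ} {y u : ℝ}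
    (hy : 0 ≤ y) (hgt : 0 ≤ gt y) (hg : 0 ≤ g y) (hu0 : 0 ≤ u) (huy : u ≤ y) :
    (1 + ξ) * optimalCoverage ξ a gt g y * gt y + ((y - optimalCoverage ξ a gt g y) +
        a / 2 * (y - optimalCoverage ξ a gt g y) ^ 2) * g y ≤
      (1 + ξ) * u * gt y + ((y - u) + a / 2 * (y - u) ^ 2) * g y := by
  by_cases h : g y = 0
  · simp only [optimalCoverage, h, if_true, min_eq_left hy]
    simp only [mul_zero, zero_mul, add_zero]
    positivity
  · simp only [optimalCoverage, h, if_false]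
    set v := y + 1 / a - gt y * (1 + ξ) / (a * g y) with hv
    have hsq := mul_le_mul_of_nonneg_left (sq_clip_sub_le (v := v) hu0 huy)
      (by positivity : 0 ≤ a * g y / 2)
    have hcost : gt y * (1 + ξ) = a * g y * (y - v) + g y := by
      rw [hv]
      field_simp
      ring
    generalize min (max v 0) y = w at hsq ⊢
    have hquad : ∀ z, (1 + ξ) * z * gt y + ((y - z) + a / 2 * (y - z) ^ 2) * g y =
        a * g y / 2 * (z - v) ^ 2 + (y * g y + a * g y / 2 * (y ^ 2 - v ^ 2)) := by
      intro z
      linear_combination z * hcost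
    rw [hquad, hquad]
    linarith

lemma costRate_optimalCoverage_le {ξ a : ℝ} (hξ : 0 ≤ ξ) (ha : 0 < a) {gt g : ℝ → ℝ}
    (hgt : IsClaimDensity gt) (hg : IsClaimDensity g) {u : ℝ → ℝ} (hu : Measurable u)
    (hu0 : ∀ y, 0 ≤ y → 0 ≤ u y ∧ u y ≤ y) :
    costRate ξ a gt g (optimalCoverage ξ a gt g) ≤ costRate ξ a gt g u := by
  have hm := measurable_optimalCoverage (ξ := ξ) (a := a) hgt.measurable hg.measurable
  have hm0 : ∀ y, 0 ≤ y → 0 ≤ optimalCoverage ξ a gt g y ∧ optimalCoverage ξ a gt g y ≤ y :=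
    fun y hy => optimalCoverage_mem hy
  rw [costRate, costRate,
    ← integral_add (integrableOn_premium hgt ξ hm hm0) (integrableOn_retained_add hg a hm hm0),
    ← integral_add (integrableOn_premium hgt ξ hu hu0) (integrableOn_retained_add hg a hu hu0)]
  exact setIntegral_mono_on
    ((integrableOn_premium hgt ξ hm hm0).add (integrableOn_retained_add hg a hm hm0))
    ((integrableOn_premium hgt ξ hu hu0).add (integrableOn_retained_add hg a hu hu0))
    measurableSet_Ioi fun y (hy : 0 < y) => optimalCoverage_pointwise_le hξ ha hy.le
      (hgt.nonneg y hy) (hg.nonneg y hy) (hu0 y hy.le).1 (hu0 y hy.le).2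

section Criterion

variable {Ω : Type*} [MeasurableSpace Ω] {P : Measure Ω} [IsProbabilityMeasure P]
  {T lam ξ a : ℝ} {gt g : ℝ → ℝ} {N : ℝ → Ω → ℕ} {Y : ℕ → Ω → ℝ} {l : ℝ → ℝ → ℝ} {t : ℝ}

lemma Admissible.measurable_retained (hl : Admissible T l) :
    Measurable (Function.uncurry fun s y => y - l s y) :=
  measurable_snd.sub hl.1

lemma Admissible.retained_mem (hl : Admissible T l) :
    ∀ s ∈ Set.Icc 0 T, ∀ y, 0 < y → 0 ≤ y - l s y ∧ y - l s y ≤ y := fun s hs y hy => by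
  have := hl.2 s hs y hy.le
  constructor <;> linarith

lemma IsClaimModel.memLp_surplus (hM : IsClaimModel P T lam g N Y) (hlam : 0 ≤ lam)
    (hg : IsClaimDensity g) (hl : Admissible T l) (ht : t ∈ Set.Icc 0 T) (x : ℝ) :
    MemLp (surplus T lam ξ gt N Y l t x T) 2 P :=
  (memLp_const _).sub
    (hM.moments_jumpIntegral hlam hg hl.measurable_retained hl.retained_mem ht).1

lemma Admissible.intervalIntegrable (hl : Admissible T l) (hgt : IsClaimDensity gt)
    (ht : t ∈ Set.Icc 0 T) :
    IntervalIntegrable (fun s => ∫ y in Set.Ioi (0 : ℝ), l s y * gt y) volume t T :=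
  (intervalIntegrable_iff_integrableOn_Ioc_of_le ht.2).2
    (integrableOn_setIntegral_mul hgt.measurable hgt.nonneg hgt.integrable_mul hl.1
      (fun s hs y hy => hl.2 s hs y hy.le) ht)

lemma Admissible.intervalIntegrable_retained (hl : Admissible T l) (hg : IsClaimDensity g)
    (ht : t ∈ Set.Icc 0 T) :
    IntervalIntegrable (fun s => ∫ y in Set.Ioi (0 : ℝ), (y - l s y) * g y) volume t T :=
  (intervalIntegrable_iff_integrableOn_Ioc_of_le ht.2).2
    (integrableOn_setIntegral_mul hg.measurable hg.nonneg hg.integrable_mul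
      hl.measurable_retained hl.retained_mem ht)

lemma Admissible.intervalIntegrable_sq_retained (hl : Admissible T l) (hg : IsClaimDensity g)
    (ht : t ∈ Set.Icc 0 T) :
    IntervalIntegrable (fun s => ∫ y in Set.Ioi (0 : ℝ), (y - l s y) ^ 2 * g y) volume t T :=
  (intervalIntegrable_iff_integrableOn_Ioc_of_le ht.2).2
    (integrableOn_setIntegral_mul (k := fun s y => (y - l s y) ^ 2)
      hg.measurable hg.nonneg hg.integrable_sq_mul (hl.measurable_retained.pow_const 2)
      (fun s hs y hy => ⟨sq_nonneg _, pow_le_pow_left₀ (hl.retained_mem s hs y hy).1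
        (hl.retained_mem s hs y hy).2 2⟩) ht)

lemma Admissible.costRate_eq (hl : Admissible T l) (hg : IsClaimDensity g) {s : ℝ}
    (hs : s ∈ Set.Icc 0 T) :
    costRate ξ a gt g (l s) = (1 + ξ) * (∫ y in Set.Ioi (0 : ℝ), l s y * gt y) +
      ((∫ y in Set.Ioi (0 : ℝ), (y - l s y) * g y) +
        a / 2 * ∫ y in Set.Ioi (0 : ℝ), (y - l s y) ^ 2 * g y) :=
  RiskType.costRate_eq hg ξ a hl.1.of_uncurry_left (hl.2 s hs)

lemma Admissible.intervalIntegrable_costRate (hl : Admissible T l) (hgt : IsClaimDensity gt)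
    (hg : IsClaimDensity g) (ht : t ∈ Set.Icc 0 T) :
    IntervalIntegrable (fun s => costRate ξ a gt g (l s)) volume t T := by
  refine (((hl.intervalIntegrable hgt ht).const_mul (1 + ξ)).add
    ((hl.intervalIntegrable_retained hg ht).add
      ((hl.intervalIntegrable_sq_retained hg ht).const_mul (a / 2)))).congr fun s hs => ?_
  rw [Set.uIoc_of_le ht.2] at hs
  exact (hl.costRate_eq hg ⟨ht.1.trans hs.1.le, hs.2⟩).symm

lemma IsClaimModel.criterion_eq (hM : IsClaimModel P T lam g N Y) (hlam : 0 ≤ lam)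
    (hgt : IsClaimDensity gt) (hg : IsClaimDensity g) (hl : Admissible T l)
    (ht : t ∈ Set.Icc 0 T) (x : ℝ) :
    criterion P T lam ξ a gt N Y t x l = x - lam * ∫ s in t..T, costRate ξ a gt g (l s) := by
  obtain ⟨hmem, hmean, hvar⟩ :=
    hM.moments_jumpIntegral hlam hg hl.measurable_retained hl.retained_mem ht
  have hcost : ∫ s in t..T, costRate ξ a gt g (l s) =
      (1 + ξ) * (∫ s in t..T, ∫ y in Set.Ioi (0 : ℝ), l s y * gt y) +
        ((∫ s in t..T, ∫ y in Set.Ioi (0 : ℝ), (y - l s y) * g y) +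
          a / 2 * ∫ s in t..T, ∫ y in Set.Ioi (0 : ℝ), (y - l s y) ^ 2 * g y) := by
    rw [← intervalIntegral.integral_const_mul, ← intervalIntegral.integral_const_mul,
      ← intervalIntegral.integral_add (hl.intervalIntegrable_retained hg ht)
        ((hl.intervalIntegrable_sq_retained hg ht).const_mul _),
      ← intervalIntegral.integral_add ((hl.intervalIntegrable hgt ht).const_mul _)
        ((hl.intervalIntegrable_retained hg ht).add
          ((hl.intervalIntegrable_sq_retained hg ht).const_mul _))]
    refine intervalIntegral.integral_congr fun s hs => ?_
    rw [Set.uIcc_of_le ht.2] at hs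
    exact hl.costRate_eq hg ⟨ht.1.trans hs.1, hs.2⟩
  have hmeanS : ∫ ω, surplus T lam ξ gt N Y l t x T ω ∂P =
      x - (∫ s in t..T, premiumRate lam ξ gt l s) -
        lam * ∫ s in t..T, ∫ y in Set.Ioi (0 : ℝ), (y - l s y) * g y := by
    unfold surplus
    rw [integral_sub (integrable_const _) (hmem.integrable one_le_two), hmean]
    simp
  have hvarS : variance (surplus T lam ξ gt N Y l t x T) P =
      lam * ∫ s in t..T, ∫ y in Set.Ioi (0 : ℝ), (y - l s y) ^ 2 * g y :=
    (variance_const_sub hmem.aestronglyMeasurable _).trans hvar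
  rw [criterion, hmeanS, hvarS, hcost]
  simp only [premiumRate, intervalIntegral.integral_const_mul]
  ring

lemma IsClaimModel.criterion_le (hM : IsClaimModel P T lam g N Y) (hlam : 0 ≤ lam)
    (hξ : 0 ≤ ξ) (ha : 0 < a) (hgt : IsClaimDensity gt) (hg : IsClaimDensity g)
    (hl : Admissible T l) (ht : t ∈ Set.Icc 0 T) (x : ℝ) :
    criterion P T lam ξ a gt N Y t x l ≤
      criterion P T lam ξ a gt N Y t x fun _ y => optimalCoverage ξ a gt g y := by
  have hopt := admissible_optimalCoverage (ξ := ξ) (a := a) (T := T) hgt.measurable hg.measurable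
  rw [hM.criterion_eq hlam hgt hg hl ht, hM.criterion_eq hlam hgt hg hopt ht]
  have := intervalIntegral.integral_mono_on ht.2
    (hopt.intervalIntegrable_costRate (ξ := ξ) (a := a) hgt hg ht)
    (hl.intervalIntegrable_costRate (ξ := ξ) (a := a) hgt hg ht) fun s hs =>
    costRate_optimalCoverage_le hξ ha hgt hg hl.1.of_uncurry_left
      (hl.2 s ⟨ht.1.trans hs.1, hs.2⟩)
  have := mul_le_mul_of_nonneg_left this hlam
  linarith

end Criterion

end RiskType

theorem proposition4p1 {Ω : Type*} [MeasurableSpace Ω] (P : MeasureTheory.Measure Ω)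
    [MeasureTheory.IsProbabilityMeasure P]
    (T lam : ℝ) (hT : 0 < T) (hlam : 0 < lam)
    (θL θH : ℝ)
    (f : ℝ → ℝ → ℝ) (hf : ∀ θ ∈ Set.Icc θL θH, RiskType.IsClaimDensity (f θ))
    (γ : ℝ → ℝ) (hγ : ∀ θ ∈ Set.Icc θL θH, 0 < γ θ)
    (ξ : ℝ → ℝ) (hξ : ∀ θ ∈ Set.Icc θL θH, 0 ≤ ξ θ)
    (θ : ℝ) (hθ : θ ∈ Set.Icc θL θH) (θt : ℝ) (hθt : θt ∈ Set.Icc θL θH)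
    (N : ℝ → Ω → ℕ) (Y : ℕ → Ω → ℝ) (hNY : RiskType.IsClaimModel P T lam (f θ) N Y)
    (xC : ℝ)
    (J : ℝ → ℝ → (ℝ → ℝ → ℝ) → ℝ)
    (hJ : J = RiskType.criterion P T lam (ξ θt) (γ θ) (f θt) N Y)
    (lhat : ℝ → ℝ) (hlhat : lhat = RiskType.optimalCoverage (ξ θt) (γ θ) (f θt) (f θ)) :
    -- terminal surpluses are square-integrable, so the criterion is well defined
    (∀ l, RiskType.Admissible T l → ∀ t ∈ Set.Icc 0 T, ∀ x : ℝ,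
      MeasureTheory.MemLp (RiskType.surplus T lam (ξ θt) (f θt) N Y l t x T) 2 P) ∧
    -- the coverage is optimal, in the equilibrium sense and for the problem at time zero
    RiskType.IsEquilibrium T J (fun _ y => lhat y) ∧
    IsMaxOn (J 0 xC) {l | RiskType.Admissible T l} (fun _ y => lhat y) ∧
    -- the value function
    J 0 xC (fun _ y => lhat y) = RiskType.customerValue T J xC ∧
    RiskType.customerValue T J xC =
      xC - lam * T *
        ((∫ y in Set.Ioi (0 : ℝ), (1 + ξ θt) * lhat y * f θt y) +
          ∫ y in Set.Ioi (0 : ℝ),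
            ((y - lhat y) + γ θ / 2 * (y - lhat y) ^ 2) * f θ y) := by
  subst hJ hlhat
  have hg := hf θ hθ
  have hgt := hf θt hθt
  have h0 : (0 : ℝ) ∈ Set.Icc 0 T := ⟨le_rfl, hT.le⟩
  have hopt := RiskType.admissible_optimalCoverage (ξ := ξ θt) (a := γ θ) (T := T)
    hgt.measurable hg.measurable
  have hle : ∀ l, RiskType.Admissible T l → ∀ t ∈ Set.Icc 0 T, ∀ x,
      RiskType.criterion P T lam (ξ θt) (γ θ) (f θt) N Y t x l ≤
        RiskType.criterion P T lam (ξ θt) (γ θ) (f θt) N Y t x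
          fun _ y => RiskType.optimalCoverage (ξ θt) (γ θ) (f θt) (f θ) y :=
    fun l hl t ht x => hNY.criterion_le hlam.le (hξ θt hθt) (hγ θ hθ) hgt hg hl ht x
  have hmax : IsMaxOn (RiskType.criterion P T lam (ξ θt) (γ θ) (f θt) N Y 0 xC)
      {l | RiskType.Admissible T l}
      (fun _ y => RiskType.optimalCoverage (ξ θt) (γ θ) (f θt) (f θ) y) :=
    isMaxOn_iff.2 fun l hl => hle l hl 0 h0 xC
  have hvalue : RiskType.customerValue T
      (RiskType.criterion P T lam (ξ θt) (γ θ) (f θt) N Y) xC =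
      RiskType.criterion P T lam (ξ θt) (γ θ) (f θt) N Y 0 xC
        (fun _ y => RiskType.optimalCoverage (ξ θt) (γ θ) (f θt) (f θ) y) :=
    IsGreatest.csSup_eq ⟨⟨_, hopt, rfl⟩, by rintro _ ⟨l, hl, rfl⟩; exact hle l hl 0 h0 xC⟩
  refine ⟨fun l hl t ht x => hNY.memLp_surplus hlam.le hg hl ht x,
    ⟨hopt, fun t ht x lbar hlbar => ?_⟩, hmax, hvalue.symm, ?_⟩
  · refine le_liminf_of_le (by isBoundedDefault) ?_
    filter_upwards [hlbar, self_mem_nhdsWithin] with ε hε hε0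
    exact_mod_cast div_nonneg (sub_nonneg.2 (hle _ hε t ht x)) (le_of_lt hε0)
  · rw [hvalue, hNY.criterion_eq hlam.le hgt hg hopt h0, intervalIntegral.integral_const,
      RiskType.costRate, smul_eq_mul, sub_zero, mul_assoc]
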